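/- Let $G\subset GL(n,\mathbb{C})$ be one of the classical groups $SL(n,\mathbb{C})$, $SO(n,\mathbb{C})$ or $Sp(N,\mathbb{C})$ (with $n=2N$), in its standard representation. Let $\mathbb{V},\mathbb{W}$ be finite dimensional complex rational representations of $G$, and let $0\neq v\in\mathbb{V}$, $0\neq w\in\mathbb{W}$. A pair $(v,w)$ is \emph{semistable} if the Zariski closures of the projective orbits $G\cdot[(v,w)]$ and $G\cdot[(v,0)]$ in $\mathbb{P}(\mathbb{V}\oplus\mathbb{W})$ are disjoint. For a maximal algebraic torus $T\leq G$ with character lattice $M_{\mathbb{Z}}$, the weight polytope $\mathcal{N}(v)\subset M_{\mathbb{Z}}\otimes_{\mathbb{Z}}\mathbb{R}$ is the convex hull of the characters $a$ for which the component $v_a$ of $v$ in the weight space $\mathbb{V}_a$ is nonzero. Let $\mathbb{I}$ be the identity matrix, regarded as a vector of the representation of $G$ on the space of $n\times n$ complex matrices by left multiplication. The degree $q=\deg(\mathbb{V})$ is the least positive integer $k$ such that $\mathcal{N}(u)\subseteq k\,\mathcal{N}(\mathbb{I})$ for all $0\neq u\in\mathbb{V}$ (for every maximal torus $T$; the condition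 does not depend on the choice of $T$). The pair $(v,w)$ is \emph{stable} if there is a positive integer $m$ such that the pair $(\mathbb{I}^{\otimes q}\otimes v^{\otimes m},\,w^{\otimes(m+1)})$ is semistable. If $(v,w)$ is stable, then its automorphism group $\mathrm{Aut}(v,w)=G_{[v]}\cap G_{[w]}$ is finite, where $G_{[v]}$ and $G_{[w]}$ denote the stabilizers in $G$ of the lines through $v$ and $w$. -/

import Mathlib

open scoped TensorProduct Pointwise Matrix

noncomputable section

namespace StablePairs

universe u u' x y

/-! ### Classical groups -/

/-- The special linear group, as a subgroup of `GL n ℂ`. -/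
def specialLinear (n : Type u) [Fintype n] [DecidableEq n] : Subgroup (GL n ℂ) :=
  (Matrix.GeneralLinearGroup.det : GL n ℂ →* ℂˣ).ker

/-- The complex special orthogonal group `{A | A * Aᵀ = 1, det A = 1}`, as a subgroup of
`GL n ℂ`. -/
def specialOrthogonal (n : Type u) [Fintype n] [DecidableEq n] : Subgroup (GL n ℂ) :=
  (Matrix.specialOrthogonalGroup n ℂ).units

/-- The complex symplectic group `Sp(N)` of `2N × 2N` matrices with `A * J * Aᵀ = J`, as a
subgroup of `GL (Fin N ⊕ Fin N) ℂ`. -/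
def symplectic (N : ℕ) : Subgroup (GL (Fin N ⊕ Fin N) ℂ) :=
  (Matrix.symplecticGroup (Fin N) ℂ).units

/-- `G` is one of the classical groups `SL`, `SO`, `Sp` in its standard representation on `ℂⁿ`.
(For `Sp`, the rows and columns are relabelled by a bijection `e`.) -/
def IsClassical {n : Type u} [Fintype n] [DecidableEq n] (G : Subgroup (GL n ℂ)) : Prop :=
  G = specialLinear n ∨ G = specialOrthogonal n ∨
    ∃ (N : ℕ) (e : Fin N ⊕ Fin N ≃ n),
      G = (symplectic N).map
        (Units.mapEquiv (Matrix.reindexAlgEquiv ℂ ℂ e).toMulEquiv).toMonoidHom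

/-! ### Regular functions, rational representations, tori -/

section Regular

variable {n : Type u} [Fintype n] [DecidableEq n]
variable {m : Type u'} [Fintype m] [DecidableEq m]

/-- A regular function on a linear algebraic group `H ≤ GL n ℂ`: the restriction of a polynomial
in the matrix entries and the inverse of the determinant. -/
def IsRegularFun (H : Subgroup (GL n ℂ)) (f : H → ℂ) : Prop :=
  ∃ (p : MvPolynomial (n × n) ℂ) (k : ℕ), ∀ h : H,
    f h = MvPolynomial.eval (fun ij : n × n => ((h : GL n ℂ) : Matrix n n ℂ) ij.1 ij.2) p *
      (((h : GL n ℂ) : Matrix n n ℂ).det⁻¹) ^ k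

/-- A homomorphism between linear groups that is given by regular functions. -/
def IsRegularHom {H : Subgroup (GL n ℂ)} {K : Subgroup (GL m ℂ)} (f : H →* K) : Prop :=
  ∀ i j, IsRegularFun H (fun h => ((f h : GL m ℂ) : Matrix m m ℂ) i j)

/-- A rational representation: all its matrix coefficients are regular functions. -/
def IsRational {G : Subgroup (GL n ℂ)} {V : Type x} [AddCommGroup V] [Module ℂ V]
    (ρ : Representation ℂ G V) : Prop :=
  ∀ (v : V) (φ : Module.Dual ℂ V), IsRegularFun G (fun g => φ (ρ g v))

/-- The group of invertible diagonal matrices, i.e. `(ℂ*)^r`. -/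
def diagonalTorus (r : ℕ) : Subgroup (GL (Fin r) ℂ) :=
  (Units.map (Matrix.diagonalRingHom (Fin r) ℂ : (Fin r → ℂ) →* Matrix (Fin r) (Fin r) ℂ)).range

/-- An algebraic torus: a linear group isomorphic, as an algebraic group, to some `(ℂ*)^r`. -/
def IsTorus (T : Subgroup (GL n ℂ)) : Prop :=
  ∃ (r : ℕ) (e : diagonalTorus r ≃* T),
    IsRegularHom e.toMonoidHom ∧ IsRegularHom e.symm.toMonoidHom

/-- A maximal algebraic torus of `G`. -/
def IsMaximalTorus (G T : Subgroup (GL n ℂ)) : Prop :=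
  Maximal (fun S : Subgroup (GL n ℂ) => S ≤ G ∧ IsTorus S) T

/-! ### Characters, weights and weight polytopes -/

theorem IsRegularFun.mul {H : Subgroup (GL n ℂ)} {f g : H → ℂ} (hf : IsRegularFun H f)
    (hg : IsRegularFun H g) : IsRegularFun H (fun h => f h * g h) := by
  obtain ⟨p, k, hp⟩ := hf
  obtain ⟨q, l, hq⟩ := hg
  refine ⟨p * q, k + l, fun h => ?_⟩
  simp only [hp, hq, map_mul, pow_add]
  ring

theorem isRegularFun_one (H : Subgroup (GL n ℂ)) : IsRegularFun H (fun _ => 1) :=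
  ⟨1, 0, fun h => by simp⟩

/-- The lattice `M_ℤ(T)` of algebraic characters `T → ℂ*`: those `χ` for which `χ` and `χ⁻¹`
are regular functions. -/
def characterLattice (T : Subgroup (GL n ℂ)) : Subgroup (T →* ℂˣ) where
  carrier := {χ | IsRegularFun T (fun t => (χ t : ℂ)) ∧ IsRegularFun T (fun t => (χ⁻¹ t : ℂ))}
  one_mem' := by
    constructor
    · simpa using isRegularFun_one T
    · simpa using isRegularFun_one T
  mul_mem' := by
    intro χ ψ h₁ h₂
    constructor
    · simpa using h₁.1.mul h₂.1
    · simpa [mul_comm] using h₁.2.mul h₂.2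
  inv_mem' := by
    intro χ h
    exact ⟨h.2, by simpa using h.1⟩

/-- The real vector space `M_ℝ(T) = M_ℤ(T) ⊗ ℝ`. -/
abbrev CharacterSpace (T : Subgroup (GL n ℂ)) : Type u :=
  ℝ ⊗[ℤ] Additive (characterLattice T)

section Weights

variable {T : Subgroup (GL n ℂ)} {V : Type x} [AddCommGroup V] [Module ℂ V]

/-- The weight space `V_a = {v | t • v = a(t) v for all t ∈ T}`. -/
def weightSpace (τ : Representation ℂ T V) (a : characterLattice T) : Submodule ℂ V where
  carrier := {v | ∀ t : T, τ t v = (((a : T →* ℂˣ) t : ℂˣ) : ℂ) • v}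
  zero_mem' := by intro t; simp
  add_mem' := by
    intro v w hv hw t
    rw [map_add, hv t, hw t, smul_add]
  smul_mem' := by
    intro c v hv t
    rw [map_smul, hv t, smul_comm]

/-- The support of `v`: the characters `a` whose component `v_a` in the (unique) decomposition
`v = ∑ v_a`, `v_a ∈ V_a`, is nonzero. -/
def support (τ : Representation ℂ T V) (v : V) : Set (characterLattice T) :=
  {a | ∃ c : characterLattice T →₀ V,
    (∀ b, c b ∈ weightSpace τ b) ∧ (c.sum fun _ z => z) = v ∧ c a ≠ 0}

/-- The weight polytope `𝒩(v) ⊆ M_ℝ`: the convex hull of the support of `v`. -/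
def weightPolytope (τ : Representation ℂ T V) (v : V) : Set (CharacterSpace T) :=
  convexHull ℝ ((fun a : characterLattice T => (1 : ℝ) ⊗ₜ[ℤ] Additive.ofMul a) '' support τ v)

end Weights

/-- The restriction of a representation of `G` to a subgroup `T ≤ G`. -/
def restrict {G T : Subgroup (GL n ℂ)} {V : Type x} [AddCommGroup V] [Module ℂ V]
    (ρ : Representation ℂ G V) (hT : T ≤ G) : Representation ℂ T V :=
  ρ.comp (Subgroup.inclusion hT)

/-- The action of `G` on square matrices by left multiplication, `(σ, A) ↦ σ * A`. -/
def leftRegular (G : Subgroup (GL n ℂ)) : Representation ℂ G (Matrix n n ℂ) where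
  toFun g := LinearMap.mulLeft ℂ ((g : GL n ℂ) : Matrix n n ℂ)
  map_one' := by ext; simp
  map_mul' g h := by
    apply LinearMap.ext
    intro A
    simp

/-- `q` is the degree of the representation `V`: the least positive integer such that
`𝒩(v) ⊆ q • 𝒩(𝕀)` for all nonzero `v` (and every maximal torus `T` of `G`, `𝕀` being the
identity matrix in the left regular representation on square matrices). -/
def IsDegree {G : Subgroup (GL n ℂ)} {V : Type x} [AddCommGroup V] [Module ℂ V]
    (ρ : Representation ℂ G V) (q : ℕ) : Prop :=
  IsLeast {k : ℕ | 0 < k ∧ ∀ (T : Subgroup (GL n ℂ)) (hT : IsMaximalTorus G T) (v : V), v ≠ 0 →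
    weightPolytope (restrict ρ hT.prop.1) v ⊆
      (k : ℝ) • weightPolytope (restrict (leftRegular G) hT.prop.1) (1 : Matrix n n ℂ)} q

end Regular

/-! ### Projective orbits and semistability -/

/-- The Zariski closure of a subset `S` of the projective space of `E`: the common zeros of all
homogeneous polynomials on `E` that vanish on `S`. Polynomials on `E` are written as polynomials
in the linear forms on `E`. -/
def zariskiClosure {E : Type x} [AddCommGroup E] [Module ℂ E] (S : Set (Projectivization ℂ E)) :
    Set (Projectivization ℂ E) :=
  {z | ∀ (d : ℕ) (p : MvPolynomial (Module.Dual ℂ E) ℂ), p.IsHomogeneous d →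
    (∀ s ∈ S, MvPolynomial.eval (fun φ : Module.Dual ℂ E => φ s.rep) p = 0) →
      MvPolynomial.eval (fun φ : Module.Dual ℂ E => φ z.rep) p = 0}

section Pairs

variable {G : Type u} [Group G] {V : Type x} [AddCommGroup V] [Module ℂ V]
  {W : Type y} [AddCommGroup W] [Module ℂ W]

/-- The projective orbit `G • [e]` of the line through a nonzero vector `e`. -/
def projOrbit {E : Type x} [AddCommGroup E] [Module ℂ E] (ρ : Representation ℂ G E) (e : E) :
    Set (Projectivization ℂ E) :=
  {z | ∃ g : G, z.submodule = Submodule.span ℂ {ρ g e}}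

/-- `(v, w)` is semistable: the Zariski closures of the orbits of `[(v, w)]` and `[(v, 0)]` in the
projective space of `V ⊕ W` are disjoint. -/
def IsSemistable (ρ : Representation ℂ G V) (σ : Representation ℂ G W) (v : V) (w : W) : Prop :=
  zariskiClosure (projOrbit (ρ.prod σ) (v, w)) ∩
    zariskiClosure (projOrbit (ρ.prod σ) (v, 0)) = ∅

/-- The representation of `G` on the tensor power `V^{⊗ k}`. -/
def tensorPow (ρ : Representation ℂ G V) (k : ℕ) : Representation ℂ G (⨂[ℂ]^k V) :=
  PiTensorProduct.mapMonoidHom.comp (MonoidHom.pi fun _ : Fin k => ρ)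

/-- The vector `v^{⊗ k}`. -/
def vecPow (v : V) (k : ℕ) : ⨂[ℂ]^k V :=
  PiTensorProduct.tprod ℂ fun _ : Fin k => v

/-- The stabilizer `G_[v]` of the line through `v`. -/
def lineStabilizer (ρ : Representation ℂ G V) (v : V) : Subgroup G where
  carrier := {g | (Submodule.span ℂ {v}).map (ρ g) = Submodule.span ℂ {v}}
  one_mem' := by
    change Submodule.map (ρ 1) _ = _
    rw [map_one]
    exact Submodule.map_id _
  mul_mem' := by
    intro g h hg hh
    change Submodule.map (ρ (g * h)) _ = _
    rw [map_mul, Module.End.mul_eq_comp, Submodule.map_comp]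
    rw [show Submodule.map (ρ h) _ = _ from hh, show Submodule.map (ρ g) _ = _ from hg]
  inv_mem' := by
    intro g hg
    have hg' : Submodule.map (ρ g) (Submodule.span ℂ {v}) = Submodule.span ℂ {v} := hg
    change Submodule.map (ρ g⁻¹) _ = _
    conv_lhs => rw [← hg']
    rw [← Submodule.map_comp, ← Module.End.mul_eq_comp, ← map_mul, inv_mul_cancel, map_one]
    exact Submodule.map_id _

/-- The automorphism group `Aut(v, w) = G_[v] ∩ G_[w]`. -/
def autGroup (ρ : Representation ℂ G V) (σ : Representation ℂ G W) (v : V) (w : W) :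
    Subgroup G :=
  lineStabilizer ρ v ⊓ lineStabilizer σ w

end Pairs

/-- `(v, w)` is stable: for some positive integer `m` the pair
`(𝕀^{⊗ q} ⊗ v^{⊗ m}, w^{⊗ (m+1)})` is semistable, where `q` is the degree of `V`. -/
def IsStable {n : Type u} [Fintype n] [DecidableEq n] {G : Subgroup (GL n ℂ)}
    {V : Type x} [AddCommGroup V] [Module ℂ V] {W : Type y} [AddCommGroup W] [Module ℂ W]
    (ρ : Representation ℂ G V) (σ : Representation ℂ G W) (v : V) (w : W) : Prop :=
  ∃ q : ℕ, IsDegree ρ q ∧ ∃ m : ℕ, 0 < m ∧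
    IsSemistable ((tensorPow (leftRegular G) q).tprod (tensorPow ρ m)) (tensorPow σ (m + 1))
      (vecPow (1 : Matrix n n ℂ) q ⊗ₜ[ℂ] vecPow v m) (vecPow w (m + 1))

end StablePairs

end

/-! The group Aut(v,w) is a bounded Zariski closed set of matrices, and such a set is finite.

Boundedness comes from `IsSemistable.exists_norm_bound`. Suppose g in Aut(v,w) scales v by a and w
by b. Semistability of the twisted pair gives δ‖g‖^q|a|^m ≤ |b|^(m+1) with δ > 0 independent of g.
Otherwise, rescaling the orbit by such elements and passing to a limit L of g/‖g‖ would put [(L^⊗q ⊗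
v^⊗m, 0)] in both orbit closures. For g⁻¹ the scalars are a⁻¹ and b⁻¹, so multiplying the two
estimates cancels them: δ²‖g‖^q‖g⁻¹‖^q ≤ 1. Since det² = 1 keeps ‖g⁻¹‖ away from zero, ‖g‖ is
bounded (`IsStable.exists_norm_le`).

Finiteness is `zeroLocus_finite_of_isBounded`: by Noether normalization, a positive-dimensional
affine variety carries a polynomial taking every complex value, so it is unbounded. -/

noncomputable section

namespace StablePairs

/-! ### Bounded affine varieties -/

/-- A `ℂ`-algebra homomorphism `R → ℂ` extends along an injective integral map `R → A` to a finite
type algebra `A`. -/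
theorem exists_algHom_comp_eq {R A : Type*} [CommRing R] [CommRing A] [Algebra ℂ R] [Algebra ℂ A]
    [Algebra.FiniteType ℂ A] (g : R →ₐ[ℂ] A) (hinj : Function.Injective g) (hint : g.IsIntegral)
    (φ : R →ₐ[ℂ] ℂ) : ∃ ψ : A →ₐ[ℂ] ℂ, ψ.comp g = φ := by
  have hsurj : Function.Surjective φ := fun c => ⟨algebraMap ℂ R c, by simp⟩
  have hmax : (RingHom.ker φ).IsMaximal := RingHom.ker_isMaximal_of_surjective φ hsurj
  algebraize [g.toRingHom]
  have : Algebra.IsIntegral R A := ⟨hint⟩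
  -- Lying over gives a maximal ideal `Q` above `ker φ`; by the Nullstellensatz its residue field is
  -- ℂ, so reduction mod `Q` is the extension.
  obtain ⟨Q, hQ, hcomap⟩ := Ideal.exists_ideal_over_maximal_of_isIntegral (S := A)
    (RingHom.ker φ) (by
      have : RingHom.ker (algebraMap R A) = ⊥ := (RingHom.injective_iff_ker_eq_bot _).mp hinj
      rw [this]; exact bot_le)
  let _ : Field (A ⧸ Q) := Ideal.Quotient.field Q
  have : Module.Finite ℂ (A ⧸ Q) := finite_of_finite_type_of_isJacobsonRing ℂ (A ⧸ Q)
  have hbij := IsAlgClosed.algebraMap_bijective_of_isIntegral (k := ℂ) (K := A ⧸ Q)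
  let e : ℂ ≃ₐ[ℂ] A ⧸ Q := AlgEquiv.ofBijective (Algebra.ofId ℂ (A ⧸ Q)) hbij
  refine ⟨(e.symm : (A ⧸ Q) →ₐ[ℂ] ℂ).comp (Ideal.Quotient.mkₐ ℂ Q), ?_⟩
  ext r
  have hr : r - algebraMap ℂ R (φ r) ∈ RingHom.ker φ := by simp [RingHom.mem_ker]
  rw [← hcomap, Ideal.mem_comap] at hr
  have hr' : g r - algebraMap ℂ A (φ r) ∈ Q := by
    have : (algebraMap R A) (r - algebraMap ℂ R (φ r)) = g r - algebraMap ℂ A (φ r) := by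
      change g _ = _
      simp
    rwa [this] at hr
  have h0 := Ideal.Quotient.eq_zero_iff_mem.mpr hr'
  rw [map_sub, sub_eq_zero] at h0
  change e.symm (Ideal.Quotient.mk Q (g r)) = φ r
  rw [h0, AlgEquiv.symm_apply_eq]
  rfl

open MvPolynomial in
/-- A bounded Zariski closed subset of affine space is finite. -/
theorem zeroLocus_finite_of_isBounded {ι : Type*} [Fintype ι] (I : Ideal (MvPolynomial ι ℂ))
    (hb : Bornology.IsBounded (zeroLocus ℂ I)) : (zeroLocus ℂ I).Finite := by
  by_cases hI : I = ⊤
  · rw [hI, zeroLocus_top]; exact Set.finite_empty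
  have : Nontrivial (MvPolynomial ι ℂ ⧸ I) := Ideal.Quotient.nontrivial_iff.mpr hI
  obtain ⟨s, g, hinj, hint⟩ := exists_integral_inj_algHom_of_fg ℂ (MvPolynomial ι ℂ ⧸ I)
  -- Noether normalization in `s` variables. For `s = 0` each coordinate is a root of a fixed monic
  -- polynomial over ℂ; for `s > 0` the first variable is an unbounded function on the zero locus.
  rcases s with _ | s
  · have hsurj : Function.Surjective (C : ℂ →+* MvPolynomial (Fin 0) ℂ) := C_surjective _
    have hint' : (g.toRingHom.comp C).IsIntegral :=
      (RingHom.isIntegral_of_surjective _ hsurj).trans _ _ hint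
    choose f hmonic hroot using fun i : ι => hint' (Ideal.Quotient.mk I (X i))
    refine (Set.Finite.pi' fun i => (f i).rootSet_finite ℂ).subset fun x hx i => ?_
    rw [Polynomial.mem_rootSet]
    refine ⟨(hmonic i).ne_zero, ?_⟩
    let ev : MvPolynomial ι ℂ ⧸ I →ₐ[ℂ] ℂ := Ideal.Quotient.liftₐ I (aeval x) hx
    have h1 := congrArg ev (hroot i)
    have hc : (g.toRingHom.comp C) = algebraMap ℂ (MvPolynomial ι ℂ ⧸ I) := by
      ext c
      exact g.commutes c
    rw [hc, ← Polynomial.aeval_def, ← Polynomial.aeval_algHom_apply, map_zero] at h1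
    rwa [show ev (Ideal.Quotient.mk I (X i)) = x i from aeval_X x i] at h1
  · exfalso
    obtain ⟨p, hp⟩ := Ideal.Quotient.mk_surjective (g (X 0))
    have hcont : Continuous fun x : ι → ℂ => eval x p := MvPolynomial.continuous_eval p
    obtain ⟨M, hM⟩ := (hb.isCompact_closure.image hcont).isBounded.exists_norm_le
    -- The polynomial `p` represents the first variable and has norm at most `M` on the locus; a
    -- point above the value `|M| + 1` contradicts this.
    obtain ⟨ψ, hψ⟩ := exists_algHom_comp_eq g hinj hint (aeval fun _ => ((|M| + 1 : ℝ) : ℂ))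
    let x : ι → ℂ := fun i => ψ (Ideal.Quotient.mk I (X i))
    have hx : ∀ q, aeval x q = ψ (Ideal.Quotient.mk I q) := by
      have : aeval x = ψ.comp (Ideal.Quotient.mkₐ ℂ I) := by ext i; simp [x]
      intro q
      rw [this]; rfl
    have hmem : x ∈ zeroLocus ℂ I := fun q hq => by
      rw [hx, Ideal.Quotient.eq_zero_iff_mem.mpr hq, map_zero]
    have h1 := hM _ ⟨x, subset_closure hmem, rfl⟩
    have h2 : eval x p = ((|M| + 1 : ℝ) : ℂ) := by
      have h3 := DFunLike.congr_fun hψ (X 0)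
      rw [AlgHom.comp_apply, ← hp, ← hx, aeval_X] at h3
      rw [← h3]; simp [aeval_eq_eval]
    simp only [h2, Complex.norm_real, Real.norm_eq_abs] at h1
    rw [abs_of_pos (by positivity)] at h1
    linarith [le_abs_self M]

section Equations

/-! ### Classical groups and line stabilizers are Zariski closed -/

theorem det_sq_eq_one_of_mem_symplecticGroup {l : Type*} [Fintype l] [DecidableEq l]
    {A : Matrix (l ⊕ l) (l ⊕ l) ℂ} (hA : A ∈ Matrix.symplecticGroup l ℂ) : A.det ^ 2 = 1 := by
  have h := congrArg Matrix.det (SymplecticGroup.mem_iff.mp hA)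
  rw [Matrix.det_mul, Matrix.det_mul, Matrix.det_transpose] at h
  refine (Matrix.isUnit_det_J l ℂ).mul_right_cancel ?_
  linear_combination h

theorem mem_map_symplectic_iff {n : Type*} [Fintype n] [DecidableEq n] {N : ℕ}
    (e : Fin N ⊕ Fin N ≃ n) (A : GL n ℂ) :
    A ∈ (symplectic N).map
        (Units.mapEquiv (Matrix.reindexAlgEquiv ℂ ℂ e).toMulEquiv).toMonoidHom ↔
      (A : Matrix n n ℂ).submatrix e e ∈ Matrix.symplecticGroup (Fin N) ℂ := by
  constructor
  · rintro ⟨B, hB, rfl⟩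
    have : (Matrix.reindexAlgEquiv ℂ ℂ e (B : Matrix _ _ ℂ)).submatrix e e = B := by
      ext i j; simp
    change (Matrix.reindexAlgEquiv ℂ ℂ e (B : Matrix _ _ ℂ)).submatrix e e ∈ _
    rw [this]
    exact hB.1
  · intro h
    have hinv : ((A : Matrix n n ℂ).submatrix e e)⁻¹ ∈ Matrix.symplecticGroup (Fin N) ℂ := by
      have := ((⟨_, h⟩ : Matrix.symplecticGroup (Fin N) ℂ)⁻¹).2
      rwa [SymplecticGroup.coe_inv'] at this
    refine ⟨(Units.mapEquiv (Matrix.reindexAlgEquiv ℂ ℂ e).toMulEquiv).symm A, ⟨h, ?_⟩,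
      MulEquiv.apply_symm_apply _ _⟩
    have heq : (((Units.mapEquiv (Matrix.reindexAlgEquiv ℂ ℂ e).toMulEquiv).symm A :
        GL (Fin N ⊕ Fin N) ℂ) : Matrix _ _ ℂ) = (A : Matrix n n ℂ).submatrix e e := rfl
    rw [← heq, ← Matrix.coe_units_inv] at hinv
    exact hinv

/-- Evaluation of a polynomial in the entries of a matrix. -/
abbrev evalEntries {n : Type*} (A : Matrix n n ℂ) : MvPolynomial (n × n) ℂ →+* ℂ :=
  MvPolynomial.eval fun ij : n × n => A ij.1 ij.2

theorem evalEntries_map_mvPolynomialX {n : Type*} (A : Matrix n n ℂ) :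
    (Matrix.mvPolynomialX n n ℂ).map (evalEntries A) = A := by
  ext i j; simp

variable {n : Type*} [Fintype n] [DecidableEq n]

/-- The square suffices for both later uses: it keeps norms away from zero, and it is a polynomial
equation forcing invertibility. For Sp it follows by taking determinants in A J Aᵀ = J. -/
theorem IsClassical.det_sq_eq_one {G : Subgroup (GL n ℂ)} (hG : IsClassical G) {A : GL n ℂ}
    (hA : A ∈ G) : (A : Matrix n n ℂ).det ^ 2 = 1 := by
  rcases hG with rfl | rfl | ⟨N, e, rfl⟩
  · have h : (A : Matrix n n ℂ).det = 1 := congrArg Units.val (MonoidHom.mem_ker.mp hA)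
    simp [h]
  · have h : (A : Matrix n n ℂ).det = 1 := hA.1.2
    simp [h]
  · rw [mem_map_symplectic_iff] at hA
    simpa using det_sq_eq_one_of_mem_symplecticGroup hA

theorem evalEntries_det (A : Matrix n n ℂ) :
    evalEntries A (Matrix.mvPolynomialX n n ℂ).det = A.det := by
  rw [RingHom.map_det, RingHom.mapMatrix_apply, evalEntries_map_mvPolynomialX]

/-- The invertible matrices in a classical group are cut out by polynomial equations. -/
theorem IsClassical.exists_equations {G : Subgroup (GL n ℂ)} (hG : IsClassical G) :
    ∃ S : Set (MvPolynomial (n × n) ℂ), ∀ A : GL n ℂ,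
      A ∈ G ↔ ∀ p ∈ S, evalEntries (A : Matrix n n ℂ) p = 0 := by
  rcases hG with rfl | rfl | ⟨N, e, rfl⟩
  · refine ⟨{(Matrix.mvPolynomialX n n ℂ).det - 1}, fun A => ?_⟩
    simp only [Set.mem_singleton_iff, forall_eq, map_sub, evalEntries_det, map_one, sub_eq_zero]
    exact Units.ext_iff
  · let X := Matrix.mvPolynomialX n n ℂ
    refine ⟨insert (X.det - 1) (Set.range fun ij : n × n => (X * Xᵀ - 1) ij.1 ij.2),
      fun A => ?_⟩
    have h1 : ∀ ij : n × n, evalEntries (A : Matrix n n ℂ) ((X * Xᵀ - 1) ij.1 ij.2) =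
        ((A : Matrix n n ℂ) * (A : Matrix n n ℂ)ᵀ - 1) ij.1 ij.2 := fun ij => by
      have : (X * Xᵀ - 1).map (evalEntries (A : Matrix n n ℂ)) =
          (A : Matrix n n ℂ) * (A : Matrix n n ℂ)ᵀ - 1 := by
        rw [Matrix.map_sub _ (map_sub _), Matrix.map_mul, Matrix.transpose_map,
          evalEntries_map_mvPolynomialX, Matrix.map_one _ (map_zero _) (map_one _)]
      rw [← this]; rfl
    simp only [Set.forall_mem_insert, Set.forall_mem_range, h1, map_sub, evalEntries_det, map_one,
      sub_eq_zero, X]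
    have h2 : A ∈ specialOrthogonal n ↔
        (A : Matrix n n ℂ) ∈ Matrix.specialOrthogonalGroup n ℂ := by
      refine ⟨fun h => h.1, fun h => ⟨h, ?_⟩⟩
      have h3 := (Matrix.mem_orthogonalGroup_iff n ℂ).mp h.1
      have h4 : ((A⁻¹ : GL n ℂ) : Matrix n n ℂ) = (A : Matrix n n ℂ)ᵀ := by
        rw [Matrix.coe_units_inv]; exact Matrix.inv_eq_right_inv h3
      change ((A⁻¹ : GL n ℂ) : Matrix n n ℂ) ∈ Matrix.specialOrthogonalGroup n ℂ
      rw [h4, Matrix.mem_specialOrthogonalGroup_iff, Matrix.mem_orthogonalGroup_iff',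
        Matrix.det_transpose, Matrix.transpose_transpose]
      exact ⟨h3, h.2⟩
    rw [h2, Matrix.mem_specialOrthogonalGroup_iff, Matrix.mem_orthogonalGroup_iff, and_comm,
      ← sub_eq_zero, ← sub_eq_zero (a := _ * _), ← Matrix.ext_iff, Prod.forall]
    rfl
  · let X := (Matrix.mvPolynomialX n n ℂ).submatrix e e
    let J := Matrix.J (Fin N) (MvPolynomial (n × n) ℂ)
    refine ⟨Set.range fun ij : (Fin N ⊕ Fin N) × (Fin N ⊕ Fin N) => (X * J * Xᵀ - J) ij.1 ij.2, fun A => ?_⟩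
    rw [mem_map_symplectic_iff, SymplecticGroup.mem_iff, ← sub_eq_zero, ← Matrix.ext_iff,
      Set.forall_mem_range, Prod.forall]
    have : (X * J * Xᵀ - J).map (evalEntries (A : Matrix n n ℂ)) =
          (A : Matrix n n ℂ).submatrix e e * Matrix.J (Fin N) ℂ *
            ((A : Matrix n n ℂ).submatrix e e)ᵀ - Matrix.J (Fin N) ℂ := by
        rw [Matrix.map_sub _ (map_sub _), Matrix.map_mul, Matrix.map_mul, Matrix.transpose_map,
          Matrix.map_J, ← Matrix.submatrix_map, evalEntries_map_mvPolynomialX]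
    rw [← this]
    rfl

theorem mem_lineStabilizer_iff {G V : Type*} [Group G] [AddCommGroup V] [Module ℂ V]
    {ρ : Representation ℂ G V} {v : V} (hv : v ≠ 0) {g : G} :
    g ∈ lineStabilizer ρ v ↔ ρ g v ∈ Submodule.span ℂ {v} := by
  change Submodule.map (ρ g) (Submodule.span ℂ {v}) = _ ↔ _
  rw [Submodule.map_span, Set.image_singleton]
  constructor
  · intro h
    rw [← h]; exact Submodule.mem_span_singleton_self _
  · intro h
    obtain ⟨a, ha⟩ := Submodule.mem_span_singleton.mp h
    have ha0 : a ≠ 0 := by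
      rintro rfl
      have h0 := ρ.inv_self_apply g v
      rw [← ha, zero_smul, map_zero] at h0
      exact hv h0.symm
    rw [← ha]
    exact Submodule.span_singleton_smul_eq (IsUnit.mk0 a ha0) v

/-- Inside `G`, line stabilizers are cut out by polynomial equations in the matrix entries. -/
theorem IsRational.exists_equations_lineStabilizer {G : Subgroup (GL n ℂ)} {V : Type*}
    [AddCommGroup V] [Module ℂ V] {ρ : Representation ℂ G V} (hρ : IsRational ρ) {v : V}
    (hv : v ≠ 0) : ∃ S : Set (MvPolynomial (n × n) ℂ), ∀ g : G,
      g ∈ lineStabilizer ρ v ↔ ∀ p ∈ S, evalEntries ((g : GL n ℂ) : Matrix n n ℂ) p = 0 := by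
  choose p k hp using hρ v
  -- Functionals killing `v` detect membership in its span. Only the numerators `p φ` matter, since
  -- the power of det⁻¹ never vanishes.
  refine ⟨p '' {φ | φ v = 0}, fun g => ?_⟩
  have hdet : ((g : GL n ℂ) : Matrix n n ℂ).det ≠ 0 :=
    ((Matrix.isUnit_iff_isUnit_det _).mp (g : GL n ℂ).isUnit).ne_zero
  have hiff : ∀ φ : Module.Dual ℂ V, φ (ρ g v) = 0 ↔
      evalEntries ((g : GL n ℂ) : Matrix n n ℂ) (p φ) = 0 := fun φ => by
    rw [show φ (ρ g v) = _ from hp φ g]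
    simp [hdet]
  rw [mem_lineStabilizer_iff hv, Set.forall_mem_image]
  simp only [← hiff]
  constructor
  · rintro h φ hφ
    obtain ⟨a, ha⟩ := Submodule.mem_span_singleton.mp h
    rw [← ha, map_smul, show φ v = 0 from hφ, smul_zero]
  · intro h
    by_contra hmem
    obtain ⟨φ, hφ, hle⟩ := Submodule.exists_le_ker_of_notMem hmem
    exact hφ (h (hle (Submodule.mem_span_singleton_self v)))

end Equations

section Semistable

open Filter Topology

/-! ### Tensor powers -/

section TensorPower

variable {V : Type*} [AddCommGroup V] [Module ℂ V]

theorem vecPow_smul (c : ℂ) (v : V) (k : ℕ) : vecPow (c • v) k = c ^ k • vecPow v k := by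
  have := (PiTensorProduct.tprod ℂ (s := fun _ : Fin k => V)).map_smul_univ (fun _ => c) fun _ => v
  simpa [vecPow] using this

theorem tensorPow_vecPow {G : Type*} [Group G] (ρ : Representation ℂ G V) (g : G) (v : V) (k : ℕ) :
    tensorPow ρ k g (vecPow v k) = vecPow (ρ g v) k :=
  PiTensorProduct.map_tprod _ _

theorem exists_dual_vecPow {v : V} (hv : v ≠ 0) (k : ℕ) :
    ∃ φ : Module.Dual ℂ (⨂[ℂ]^k V), φ (vecPow v k) ≠ 0 := by
  obtain ⟨φ, hφ⟩ : ∃ φ : Module.Dual ℂ V, φ v ≠ 0 := by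
    by_contra! h
    exact hv ((Module.forall_dual_apply_eq_zero_iff ℂ v).mp h)
  refine ⟨PiTensorProduct.lift
    ((MultilinearMap.mkPiAlgebra ℂ (Fin k) ℂ).compLinearMap fun _ => φ), ?_⟩
  rw [vecPow, PiTensorProduct.lift.tprod]
  simp [hφ]

theorem vecPow_tmul_vecPow_ne_zero {W : Type*} [AddCommGroup W] [Module ℂ W] {v : V} {w : W}
    (hv : v ≠ 0) (hw : w ≠ 0) (k l : ℕ) : vecPow v k ⊗ₜ[ℂ] vecPow w l ≠ 0 := by
  obtain ⟨φ, hφ⟩ := exists_dual_vecPow hv k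
  obtain ⟨ψ, hψ⟩ := exists_dual_vecPow hw l
  intro h
  have := congrArg ((TensorProduct.lid ℂ ℂ).toLinearMap ∘ₗ TensorProduct.map φ ψ) h
  simp [hφ, hψ] at this

/-- Expanding in matrix units makes the function a polynomial in the entries, so no topology on the
tensor power is needed. -/
theorem continuous_dual_vecPow {n : Type*} [Fintype n] [DecidableEq n] (k : ℕ)
    (φ : Module.Dual ℂ (⨂[ℂ]^k (Matrix n n ℂ))) :
    Continuous fun A : Matrix n n ℂ => φ (vecPow A k) := by
  have h : ∀ A : Matrix n n ℂ, φ (vecPow A k) = ∑ r : Fin k → n × n,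
      (∏ i, A (r i).1 (r i).2) *
        φ (PiTensorProduct.tprod ℂ fun i => Matrix.single (r i).1 (r i).2 (1 : ℂ)) := by
    intro A
    have hA : A = ∑ x : n × n, A x.1 x.2 • Matrix.single x.1 x.2 (1 : ℂ) := by
      conv_lhs => rw [Matrix.matrix_eq_sum_single A]
      rw [Fintype.sum_prod_type]
      simp [Matrix.smul_single]
    conv_lhs => rw [hA]
    rw [vecPow, MultilinearMap.map_sum, map_sum]
    refine Finset.sum_congr rfl fun r _ => ?_
    rw [MultilinearMap.map_smul_univ, map_smul, smul_eq_mul]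
  simp only [h]
  fun_prop

end TensorPower

/-! ### Limits in projective space -/

section Closure

variable {E : Type*} [AddCommGroup E] [Module ℂ E]

/-- This frees the closure condition from the chosen representatives `rep`. -/
theorem eval_smul_eq_zero_iff {d : ℕ} {p : MvPolynomial (Module.Dual ℂ E) ℂ}
    (hp : p.IsHomogeneous d) {c : ℂ} (hc : c ≠ 0) (x : E) :
    MvPolynomial.eval (fun φ : Module.Dual ℂ E => φ (c • x)) p = 0 ↔
      MvPolynomial.eval (fun φ : Module.Dual ℂ E => φ x) p = 0 := by
  have : MvPolynomial.eval (fun φ : Module.Dual ℂ E => φ (c • x)) p =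
      c ^ d * MvPolynomial.eval (fun φ : Module.Dual ℂ E => φ x) p := by
    rw [MvPolynomial.eval_eq, MvPolynomial.eval_eq, Finset.mul_sum]
    refine Finset.sum_congr rfl fun s hs => ?_
    have hd : ∑ i ∈ s.support, s i = d := by
      have := hp (MvPolynomial.mem_support_iff.mp hs)
      rwa [show Finsupp.weight (1 : Module.Dual ℂ E → ℕ) s = s.degree from
        (DFunLike.congr_fun Finsupp.degree_eq_weight_one s).symm] at this
    simp only [map_smul, smul_eq_mul, mul_pow, Finset.prod_mul_distrib, Finset.prod_pow_eq_pow_sum,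
      hd]
    ring
  rw [this, mul_eq_zero, or_iff_right (pow_ne_zero _ hc)]

/-- The Zariski closure of an orbit in projective space contains its limits for the weak
topology. -/
theorem mk_mem_zariskiClosure_of_tendsto {G : Type*} [Group G] {ρ : Representation ℂ G E} {e : E}
    (he : e ≠ 0) {x : ℕ → E} {y : E} (hy : y ≠ 0)
    (hx : ∀ k, ∃ (g : G) (c : ℂ), c ≠ 0 ∧ x k = c • ρ g e)
    (hlim : ∀ φ : Module.Dual ℂ E, Tendsto (fun k => φ (x k)) atTop (𝓝 (φ y))) :
    Projectivization.mk ℂ y hy ∈ zariskiClosure (projOrbit ρ e) := by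
  intro d p hp hvan
  have hzero : ∀ k, MvPolynomial.eval (fun φ : Module.Dual ℂ E => φ (x k)) p = 0 := by
    intro k
    obtain ⟨g, c, hc, hxk⟩ := hx k
    have hge : ρ g e ≠ 0 := fun h => he (by rw [← ρ.inv_self_apply g e, h, map_zero])
    obtain ⟨a, ha⟩ := Projectivization.exists_smul_eq_mk_rep ℂ (ρ g e) hge
    have h := hvan (Projectivization.mk ℂ (ρ g e) hge) ⟨g, Projectivization.submodule_mk _ _⟩
    rw [← ha, Units.smul_def, eval_smul_eq_zero_iff hp a.ne_zero] at h
    rwa [hxk, eval_smul_eq_zero_iff hp hc]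
  obtain ⟨a, ha⟩ := Projectivization.exists_smul_eq_mk_rep ℂ y hy
  rw [← ha, Units.smul_def, eval_smul_eq_zero_iff hp a.ne_zero]
  have ht := ((MvPolynomial.continuous_eval p).tendsto _).comp (tendsto_pi_nhds.mpr hlim)
  refine tendsto_nhds_unique ht ?_
  simp only [Function.comp_def, hzero, tendsto_const_nhds_iff]

end Closure

/-! ### The growth estimate -/

section Estimate

open scoped Matrix.Norms.Elementwise

variable {n : Type*} [Fintype n] [DecidableEq n] {G : Subgroup (GL n ℂ)}
  {V : Type*} [AddCommGroup V] [Module ℂ V] {W : Type*} [AddCommGroup W] [Module ℂ W]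

/-- On the automorphism group of a pair whose twist is semistable, the norm of `g` is controlled by
the eigenvalues of `g` at the two vectors. -/
theorem IsSemistable.exists_norm_bound {ρ : Representation ℂ G V} {σ : Representation ℂ G W}
    {v : V} (hv : v ≠ 0) {w : W} {q m : ℕ} (hq : 0 < q)
    (hss : IsSemistable ((tensorPow (leftRegular G) q).tprod (tensorPow ρ m))
      (tensorPow σ (m + 1)) (vecPow (1 : Matrix n n ℂ) q ⊗ₜ[ℂ] vecPow v m) (vecPow w (m + 1))) :
    ∃ δ : ℝ, 0 < δ ∧ ∀ (g : G) (a b : ℂ), ρ g v = a • v → σ g w = b • w →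
      δ * (‖((g : GL n ℂ) : Matrix n n ℂ)‖ ^ q * ‖a‖ ^ m) ≤ ‖b‖ ^ (m + 1) := by
  by_contra! hcon
  choose g a b ha hb hlt using fun k : ℕ => hcon (1 / ((k : ℝ) + 1)) (by positivity)
  let r : ℕ → ℝ := fun k => ‖((g k : GL n ℂ) : Matrix n n ℂ)‖
  -- If the norm vanished, so would its `q`-th power, as `q > 0`, and a nonnegative number would be
  -- less than 0.
  have hr0 : ∀ k, r k ≠ 0 := fun k h => by
    have := hlt k
    rw [show ‖((g k : GL n ℂ) : Matrix n n ℂ)‖ = 0 from h, zero_pow hq.ne'] at this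
    simp only [zero_mul, mul_zero] at this
    exact absurd this (not_lt.mpr (by positivity))
  have ha0 : ∀ k, a k ^ m ≠ 0 := fun k h => by
    have := hlt k
    rw [← norm_pow (a k), h, norm_zero] at this
    simp only [mul_zero] at this
    exact absurd this (not_lt.mpr (by positivity))
  have hr : ∀ k, 0 < r k := fun k => lt_of_le_of_ne (norm_nonneg _) (hr0 k).symm
  -- This scaling turns the first component of the orbit point into (g/‖g‖)^⊗q ⊗ v^⊗m; the second
  -- becomes `s k` times w^⊗(m+1), with ‖s k‖ at most 1/(k+1).
  let c : ℕ → ℂ := fun k => (a k ^ m * (r k : ℂ) ^ q)⁻¹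
  have hc0 : ∀ k, c k ≠ 0 := fun k =>
    inv_ne_zero (mul_ne_zero (ha0 k) (pow_ne_zero _ (Complex.ofReal_ne_zero.mpr (hr0 k))))
  let s : ℕ → ℂ := fun k => c k * b k ^ (m + 1)
  have hs : Tendsto s atTop (𝓝 0) := by
    refine squeeze_zero_norm (fun k => ?_) tendsto_one_div_add_atTop_nhds_zero_nat
    have h1 : 0 < ‖a k ^ m * (r k : ℂ) ^ q‖ := by
      rw [norm_pos_iff, ← inv_inv (_ * _)]; exact inv_ne_zero (hc0 k)
    rw [show s k = (a k ^ m * (r k : ℂ) ^ q)⁻¹ * b k ^ (m + 1) from rfl, norm_mul, norm_inv,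
      inv_mul_le_iff₀ h1]
    have h2 := (hlt k).le
    rw [norm_mul, norm_pow, norm_pow, norm_pow, Complex.norm_real, Real.norm_of_nonneg (hr k).le]
    change _ ≤ 1 / ((k : ℝ) + 1) * (r k ^ q * _) at h2
    linarith
  let B : ℕ → Matrix n n ℂ := fun k => ((r k)⁻¹ : ℂ) • ((g k : GL n ℂ) : Matrix n n ℂ)
  have hB : ∀ k, B k ∈ Metric.sphere (0 : Matrix n n ℂ) 1 := fun k => by
    rw [mem_sphere_zero_iff_norm, norm_smul, norm_inv, Complex.norm_real,
      Real.norm_of_nonneg (hr k).le]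
    exact inv_mul_cancel₀ (hr0 k)
  have : ProperSpace (Matrix n n ℂ) := FiniteDimensional.proper ℂ _
  obtain ⟨L, hL, f, hf, hlimB⟩ := (isCompact_sphere (0 : Matrix n n ℂ) 1).tendsto_subseq hB
  have hL0 : L ≠ 0 := ne_zero_of_mem_unit_sphere ⟨L, hL⟩
  have hBpow : ∀ k, vecPow (B k) q ⊗ₜ[ℂ] vecPow v m = c k •
      ((tensorPow (leftRegular G) q).tprod (tensorPow ρ m)) (g k)
        (vecPow (1 : Matrix n n ℂ) q ⊗ₜ[ℂ] vecPow v m) := fun k => by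
    rw [Representation.tprod_apply, TensorProduct.map_tmul, tensorPow_vecPow, tensorPow_vecPow, ha,
      vecPow_smul, vecPow_smul, TensorProduct.tmul_smul, smul_smul, ← TensorProduct.smul_tmul']
    have h1 : leftRegular G (g k) 1 = ((g k : GL n ℂ) : Matrix n n ℂ) := mul_one _
    rw [h1]
    congr 1
    simp only [c]
    rw [mul_inv, mul_right_comm, inv_mul_cancel₀ (ha0 k), one_mul, inv_pow]
  have hWpow : ∀ k, s k • vecPow w (m + 1) = c k • tensorPow σ (m + 1) (g k) (vecPow w (m + 1)) :=
    fun k => by rw [tensorPow_vecPow, hb, vecPow_smul, smul_smul]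
  have hvec := vecPow_tmul_vecPow_ne_zero hL0 hv q m
  have hone : (1 : Matrix n n ℂ) ≠ 0 := fun h => hL0 (by rw [← one_mul L, h, zero_mul])
  have hvec1 := vecPow_tmul_vecPow_ne_zero hone hv q m
  have hcont : ∀ φ : Module.Dual ℂ ((⨂[ℂ]^q (Matrix n n ℂ)) ⊗[ℂ] (⨂[ℂ]^m V)),
      Tendsto (fun k => φ (vecPow (B (f k)) q ⊗ₜ[ℂ] vecPow v m)) atTop
        (𝓝 (φ (vecPow L q ⊗ₜ[ℂ] vecPow v m))) := fun φ =>
    ((continuous_dual_vecPow q (φ ∘ₗ (TensorProduct.mk ℂ _ _).flip (vecPow v m))).tendsto L).comp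
      hlimB
  have hy : ((vecPow L q ⊗ₜ[ℂ] vecPow v m, 0) :
      ((⨂[ℂ]^q (Matrix n n ℂ)) ⊗[ℂ] (⨂[ℂ]^m V)) × ⨂[ℂ]^(m + 1) W) ≠ 0 := fun h =>
    hvec (congrArg Prod.fst h)
  have hsplit : ∀ (φ : Module.Dual ℂ
      (((⨂[ℂ]^q (Matrix n n ℂ)) ⊗[ℂ] (⨂[ℂ]^m V)) × ⨂[ℂ]^(m + 1) W)) x y,
      φ (x, y) = (φ ∘ₗ LinearMap.inl ℂ _ _) x + (φ ∘ₗ LinearMap.inr ℂ _ _) y := fun φ x y => by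
    simp [← map_add]
  -- The same group elements and scalars approach this point along both orbits.
  refine Set.eq_empty_iff_forall_notMem.mp hss (Projectivization.mk ℂ _ hy) ⟨?_, ?_⟩
  · refine mk_mem_zariskiClosure_of_tendsto
      (x := fun k => (vecPow (B (f k)) q ⊗ₜ[ℂ] vecPow v m, s (f k) • vecPow w (m + 1)))
      (fun h => hvec1 (congrArg Prod.fst h)) hy (fun k => ⟨g (f k), c (f k), hc0 _, ?_⟩) fun φ => ?_
    · rw [hBpow, hWpow]; rfl
    · simp only [hsplit φ]
      refine (hcont _).add ?_
      simp only [map_smul, map_zero, smul_eq_mul]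
      simpa using (hs.comp hf.tendsto_atTop).mul_const
        ((φ ∘ₗ LinearMap.inr ℂ _ _) (vecPow w (m + 1)))
  · refine mk_mem_zariskiClosure_of_tendsto
      (x := fun k => (vecPow (B (f k)) q ⊗ₜ[ℂ] vecPow v m, 0))
      (fun h => hvec1 (congrArg Prod.fst h)) hy (fun k => ⟨g (f k), c (f k), hc0 _, ?_⟩) fun φ => ?_
    · rw [hBpow]
      change _ = c (f k) • ((_ : _ ⊗[ℂ] _), tensorPow σ (m + 1) (g (f k)) 0)
      rw [map_zero, Prod.smul_mk, smul_zero]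
      rfl
    · simp only [hsplit φ]
      exact (hcont _).add tendsto_const_nhds

end Estimate

end Semistable

/-! ### Finiteness of the automorphism group -/

section Finiteness

open scoped Matrix.Norms.Elementwise

variable {n : Type*} [Fintype n] [DecidableEq n] {G : Subgroup (GL n ℂ)}
  {V : Type*} [AddCommGroup V] [Module ℂ V] {W : Type*} [AddCommGroup W] [Module ℂ W]

/-- By continuity det² stays within distance 1 of its value 0 at the zero matrix; that value is 0
only when `n` is nonempty. -/
theorem exists_norm_ge_of_det_sq_eq_one [Nonempty n] :
    ∃ ε : ℝ, 0 < ε ∧ ∀ A : Matrix n n ℂ, A.det ^ 2 = 1 → ε ≤ ‖A‖ := by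
  have hcont : Continuous fun A : Matrix n n ℂ => A.det ^ 2 := by fun_prop
  obtain ⟨ε, hε, h⟩ := Metric.continuous_iff.mp hcont 0 1 one_pos
  refine ⟨ε, hε, fun A hA => ?_⟩
  by_contra! hlt
  have := h A (by simpa using hlt)
  rw [hA, Matrix.det_zero] at this
  simp at this

theorem exists_smul_of_mem_lineStabilizer {G : Type*} [Group G] {ρ : Representation ℂ G V} {v : V}
    (hv : v ≠ 0) {g : G} (hg : g ∈ lineStabilizer ρ v) :
    ∃ a : ℂ, a ≠ 0 ∧ ρ g v = a • v ∧ ρ g⁻¹ v = a⁻¹ • v := by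
  obtain ⟨a, ha⟩ := Submodule.mem_span_singleton.mp ((mem_lineStabilizer_iff hv).mp hg)
  have hinv := ρ.inv_self_apply g v
  rw [← ha, map_smul] at hinv
  have ha0 : a ≠ 0 := by
    rintro rfl
    exact hv (by rw [← hinv, zero_smul])
  exact ⟨a, ha0, ha.symm, (eq_inv_smul_iff₀ ha0).mpr hinv⟩

/-- The matrices in the automorphism group of a stable pair are uniformly bounded. -/
theorem IsStable.exists_norm_le [Nonempty n] (hdet : ∀ A ∈ G, (A : Matrix n n ℂ).det ^ 2 = 1)
    {ρ : Representation ℂ G V} {σ : Representation ℂ G W} {v : V} (hv : v ≠ 0) {w : W}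
    (hw : w ≠ 0) (hst : IsStable ρ σ v w) :
    ∃ M : ℝ, ∀ g ∈ autGroup ρ σ v w, ‖((g : GL n ℂ) : Matrix n n ℂ)‖ ≤ M := by
  obtain ⟨q, hq, m, -, hss⟩ := hst
  have hq0 : 0 < q := hq.1.1
  obtain ⟨δ, hδ, hbound⟩ := hss.exists_norm_bound hv hq0
  obtain ⟨ε, hε, hnorm⟩ := exists_norm_ge_of_det_sq_eq_one (n := n)
  -- The estimate bounds ‖g‖^q, which dominates ‖g‖ only when ‖g‖ ≥ 1; hence the maximum with 1.
  refine ⟨max 1 (δ ^ 2 * ε ^ q)⁻¹, fun g hg => ?_⟩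
  obtain ⟨a, ha0, ha, ha'⟩ := exists_smul_of_mem_lineStabilizer hv hg.1
  obtain ⟨b, hb0, hb, hb'⟩ := exists_smul_of_mem_lineStabilizer hw hg.2
  have h1 := hbound g a b ha hb
  have h2 := hbound g⁻¹ a⁻¹ b⁻¹ ha' hb'
  have h3 : ε ≤ ‖((g⁻¹ : G) : GL n ℂ).val‖ := hnorm _ (hdet _ (g⁻¹).2)
  have hna : 0 < ‖a‖ := norm_pos_iff.mpr ha0
  have hnb : 0 < ‖b‖ := norm_pos_iff.mpr hb0
  set x := ‖((g : GL n ℂ) : Matrix n n ℂ)‖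
  set y := ‖((g⁻¹ : G) : GL n ℂ).val‖
  have hx : 0 ≤ x := norm_nonneg _
  have h4 : δ ^ 2 * ε ^ q * x ^ q ≤ 1 := by
    calc δ ^ 2 * ε ^ q * x ^ q ≤ δ ^ 2 * y ^ q * x ^ q := by gcongr
      _ = (δ * (x ^ q * ‖a‖ ^ m)) * (δ * (y ^ q * ‖a⁻¹‖ ^ m)) := by
        rw [norm_inv, inv_pow]; field_simp
      _ ≤ ‖b‖ ^ (m + 1) * ‖b⁻¹‖ ^ (m + 1) := by gcongr
      _ = 1 := by rw [← mul_pow, norm_inv, mul_inv_cancel₀ hnb.ne', one_pow]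
  rcases le_total x 1 with hx1 | hx1
  · exact le_max_of_le_left hx1
  · refine le_max_of_le_right ?_
    rw [← one_div, le_div_iff₀' (by positivity)]
    exact (mul_le_mul_of_nonneg_left (le_self_pow₀ hx1 hq0.ne') (by positivity)).trans h4

end Finiteness

open scoped Matrix.Norms.Elementwise in
theorem IsStable.finite_autGroup {n : Type*} [Fintype n] [DecidableEq n]
    {G : Subgroup (GL n ℂ)} (hG : IsClassical G)
    {V : Type*} [AddCommGroup V] [Module ℂ V] {W : Type*} [AddCommGroup W] [Module ℂ W]
    {ρ : Representation ℂ G V} (hρ : IsRational ρ) {σ : Representation ℂ G W} (hσ : IsRational σ)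
    {v : V} (hv : v ≠ 0) {w : W} (hw : w ≠ 0) (hst : IsStable ρ σ v w) :
    Finite (autGroup ρ σ v w) := by
  cases isEmpty_or_nonempty n
  · have : Subsingleton (GL n ℂ) := ⟨fun A B => Units.ext (Subsingleton.elim _ _)⟩
    infer_instance
  obtain ⟨S₁, hS₁⟩ := hG.exists_equations
  obtain ⟨S₂, hS₂⟩ := hρ.exists_equations_lineStabilizer hv
  obtain ⟨S₃, hS₃⟩ := hσ.exists_equations_lineStabilizer hw
  obtain ⟨M, hM⟩ := hst.exists_norm_le (fun A => hG.det_sq_eq_one) hv hw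
  -- The other equations characterize the group only among invertible matrices; `D` makes it closed
  -- in the space of all matrices.
  let D : MvPolynomial (n × n) ℂ := (Matrix.mvPolynomialX n n ℂ).det ^ 2 - 1
  let I : Ideal (MvPolynomial (n × n) ℂ) := Ideal.span (S₁ ∪ S₂ ∪ S₃ ∪ {D})
  let entries : autGroup ρ σ v w → n × n → ℂ := fun g ij =>
    ((g : G) : GL n ℂ).val ij.1 ij.2
  have hinj : Function.Injective entries := fun g h hgh =>
    Subtype.ext <| Subtype.ext <| Units.ext <| Matrix.ext fun i j => congrFun hgh (i, j)
  have hmem : MvPolynomial.zeroLocus ℂ I = Set.range entries := by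
    rw [MvPolynomial.zeroLocus_span]
    ext x
    have hD : ∀ A : Matrix n n ℂ, evalEntries A D = 0 ↔ A.det ^ 2 = 1 := fun A => by
      rw [map_sub, map_pow, evalEntries_det, map_one, sub_eq_zero]
    constructor
    · intro hx
      let A : Matrix n n ℂ := Matrix.of fun i j => x (i, j)
      have hev : ∀ p ∈ S₁ ∪ S₂ ∪ S₃ ∪ {D}, evalEntries A p = 0 := hx
      have hdet : A.det ^ 2 = 1 := (hD A).mp (hev D (Or.inr rfl))
      have hunit : IsUnit A := (Matrix.isUnit_iff_isUnit_det A).mpr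
        (IsUnit.of_pow_eq_one hdet two_ne_zero)
      let u : GL n ℂ := hunit.unit
      have hu : u ∈ G := (hS₁ u).mpr fun p hp => hev p (Or.inl (Or.inl (Or.inl hp)))
      exact ⟨⟨⟨u, hu⟩, (hS₂ ⟨u, hu⟩).mpr fun p hp => hev p (Or.inl (Or.inl (Or.inr hp))),
        (hS₃ ⟨u, hu⟩).mpr fun p hp => hev p (Or.inl (Or.inr hp))⟩, rfl⟩
    · rintro ⟨g, rfl⟩ p (((hp | hp) | hp) | rfl)
      · exact (hS₁ _).mp g.1.2 p hp
      · exact (hS₂ _).mp g.2.1 p hp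
      · exact (hS₃ _).mp g.2.2 p hp
      · exact (hD _).mpr (hG.det_sq_eq_one g.1.2)
  have hfin : (Set.range entries).Finite := by
    rw [← hmem]
    refine zeroLocus_finite_of_isBounded I (hmem ▸ isBounded_iff_forall_norm_le.mpr ⟨M, ?_⟩)
    rintro _ ⟨g, rfl⟩
    have hMg := hM g.1 g.2
    refine (pi_norm_le_iff_of_nonneg ((norm_nonneg _).trans hMg)).mpr fun ij => ?_
    exact (Matrix.norm_entry_le_entrywise_sup_norm ((g : G) : GL n ℂ).val).trans hMg
  have := hfin.to_subtype
  exact Finite.of_injective_finite_range hinj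

end StablePairs

end

theorem mainTheorem6 {n : Type*} [Fintype n] [DecidableEq n]
    (G : Subgroup (GL n ℂ)) (hG : StablePairs.IsClassical G)
    {V : Type*} [AddCommGroup V] [Module ℂ V] [FiniteDimensional ℂ V]
    {W : Type*} [AddCommGroup W] [Module ℂ W] [FiniteDimensional ℂ W]
    (ρ : Representation ℂ G V) (hρ : StablePairs.IsRational ρ)
    (σ : Representation ℂ G W) (hσ : StablePairs.IsRational σ)
    (v : V) (hv : v ≠ 0) (w : W) (hw : w ≠ 0)
    (hstable : StablePairs.IsStable ρ σ v w) :
    Finite (StablePairs.autGroup ρ σ v w) :=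
  hstable.finite_autGroup hG hρ hσ hv hw
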